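/- Let $\mathbb K\in\{\mathbb R,\mathbb C\}$ and let $(B_0,B_1)$ be an interpolation couple, i.e. $B_0,B_1$ are Banach spaces over $\mathbb K$ continuously and linearly embedded in a common Hausdorff topological vector space. Let $\theta\in(0,1)$ and $p\in(1,\infty)$. For $t>0$ and $a\in B_0+B_1$ put $$K(t,a)=\inf\{\|a_0\|_{B_0}+t\|a_1\|_{B_1} : a=a_0+a_1,\ a_j\in B_j\},$$ and let $$B_{\theta,p}=\Big\{a\in B_0+B_1 : \|a\|_{B_{\theta,p}}=\Big(\int_0^\infty \big(t^{-\theta}K(t,a)\big)^p\,\tfrac{dt}{t}\Big)^{1/p}<\infty\Big\}$$ be the real interpolation space. A norm $\|\cdot\|$ on a Banach space $X$ is called weakly uniformly rotund (WUR) if $x_n-y_n\to 0$ in the weak topology of $X$ whenever $x_n,y_n\in X$, $\|x_n\|=\|y_n\|=1$ and $\lim_{n\to\infty}\|x_n+y_n\|=2$. If the norm of $B_0$ is WUR, then $B_{\theta,p}$ admits an equivalent WUR norm. -/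

import Mathlib

open Set Filter Topology MeasureTheory
open scoped ENNReal

/-- A norm `N` (given as a seminorm, equivalent to the norm of `X` in all uses below) on the
normed space `X` is weakly uniformly rotund: if `x n`, `y n` lie in its unit sphere and
`N (x n + y n) → 2`, then `x n - y n → 0` in the weak topology of `X`. (Equivalent norms have
the same weak topology.) -/
def IsWUR {𝕜 X : Type*} [RCLike 𝕜] [NormedAddCommGroup X] [NormedSpace 𝕜 X]
    (N : Seminorm 𝕜 X) : Prop :=
  ∀ x y : ℕ → X, (∀ n, N (x n) = 1) → (∀ n, N (y n) = 1) →
    Tendsto (fun n => N (x n + y n)) atTop (𝓝 2) →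
    Tendsto (fun n => toWeakSpace 𝕜 X (x n - y n)) atTop (𝓝 0)

/-- `N` is a norm on `X` equivalent to the given one. -/
def IsEquivalentNorm {𝕜 X : Type*} [RCLike 𝕜] [NormedAddCommGroup X] [NormedSpace 𝕜 X]
    (N : Seminorm 𝕜 X) : Prop :=
  ∃ c C : ℝ, 0 < c ∧ 0 < C ∧ ∀ x : X, c * ‖x‖ ≤ N x ∧ N x ≤ C * ‖x‖

/-- An interpolation couple: two Banach spaces `B₀`, `B₁` continuously and linearly embedded in
a common Hausdorff topological vector space `V`. -/
structure InterpolationCouple (𝕜 B₀ B₁ V : Type*) [RCLike 𝕜]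
    [NormedAddCommGroup B₀] [NormedSpace 𝕜 B₀] [CompleteSpace B₀]
    [NormedAddCommGroup B₁] [NormedSpace 𝕜 B₁] [CompleteSpace B₁]
    [AddCommGroup V] [Module 𝕜 V] [TopologicalSpace V] [IsTopologicalAddGroup V]
    [ContinuousSMul 𝕜 V] [T2Space V] where
  /-- the embedding of `B₀` -/
  j₀ : B₀ →L[𝕜] V
  /-- the embedding of `B₁` -/
  j₁ : B₁ →L[𝕜] V
  injective_j₀ : Function.Injective j₀
  injective_j₁ : Function.Injective j₁

namespace InterpolationCouple

variable {𝕜 B₀ B₁ V : Type*} [RCLike 𝕜]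
  [NormedAddCommGroup B₀] [NormedSpace 𝕜 B₀] [CompleteSpace B₀]
  [NormedAddCommGroup B₁] [NormedSpace 𝕜 B₁] [CompleteSpace B₁]
  [AddCommGroup V] [Module 𝕜 V] [TopologicalSpace V] [IsTopologicalAddGroup V]
  [ContinuousSMul 𝕜 V] [T2Space V]

/-- Peetre's functional `K(t, a)`, the infimum of `‖a₀‖ + t ‖a₁‖` over all decompositions
`a = a₀ + a₁`. It is `⊤` when `a` is not in `B₀ + B₁`. -/
noncomputable def K (B : InterpolationCouple 𝕜 B₀ B₁ V) (t : ℝ) (a : V) : ℝ≥0∞ :=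
  ⨅ (a₀ : B₀) (a₁ : B₁) (_ : B.j₀ a₀ + B.j₁ a₁ = a),
    ENNReal.ofReal ‖a₀‖ + ENNReal.ofReal t * ENNReal.ofReal ‖a₁‖

/-- The extended real number `(∫₀^∞ (t^(-θ) K(t, a))^p dt/t)^(1/p)`. -/
noncomputable def eNorm (B : InterpolationCouple 𝕜 B₀ B₁ V) (θ p : ℝ) (a : V) : ℝ≥0∞ :=
  (∫⁻ t in Ioi (0 : ℝ),
    (B.K t a / ENNReal.ofReal (t ^ θ)) ^ p / ENNReal.ofReal t) ^ (1 / p)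

theorem K_zero (B : InterpolationCouple 𝕜 B₀ B₁ V) (t : ℝ) : B.K t 0 = 0 := by
  refine le_antisymm ?_ bot_le
  refine iInf_le_of_le 0 (iInf_le_of_le 0 (iInf_le_of_le (by simp) (by simp)))

theorem K_add_le (B : InterpolationCouple 𝕜 B₀ B₁ V) (t : ℝ) (a b : V) :
    B.K t (a + b) ≤ B.K t a + B.K t b := by
  simp only [K, ENNReal.iInf_add, ENNReal.add_iInf]
  refine le_iInf fun b₀ => le_iInf fun b₁ => le_iInf fun hb => le_iInf fun a₀ =>
    le_iInf fun a₁ => le_iInf fun ha => ?_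
  refine iInf_le_of_le (a₀ + b₀) (iInf_le_of_le (a₁ + b₁) (iInf_le_of_le ?_ ?_))
  · rw [← ha, ← hb, map_add, map_add]; abel
  · simp only [ofReal_norm]
    calc ‖a₀ + b₀‖ₑ + ENNReal.ofReal t * ‖a₁ + b₁‖ₑ
        ≤ (‖a₀‖ₑ + ‖b₀‖ₑ) + ENNReal.ofReal t * (‖a₁‖ₑ + ‖b₁‖ₑ) := by
          gcongr <;> exact enorm_add_le _ _
      _ = _ := by ring

theorem K_smul_le (B : InterpolationCouple 𝕜 B₀ B₁ V) (t : ℝ) (c : 𝕜) (a : V) :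
    B.K t (c • a) ≤ ‖c‖ₑ * B.K t a := by
  by_cases hc : c = 0
  · subst hc; simp [K_zero]
  simp only [K, ENNReal.mul_iInf_of_ne (enorm_ne_zero.2 hc) enorm_ne_top]
  refine le_iInf fun a₀ => le_iInf fun a₁ => le_iInf fun ha => ?_
  refine iInf_le_of_le (c • a₀) (iInf_le_of_le (c • a₁) (iInf_le_of_le ?_ ?_))
  · rw [← ha, map_smul, map_smul, smul_add]
  · simp only [ofReal_norm, enorm_smul]
    apply le_of_eq; ring

theorem K_mono (B : InterpolationCouple 𝕜 B₀ B₁ V) (a : V) : Monotone fun t => B.K t a := by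
  intro s t hst
  refine iInf_mono fun a₀ => iInf_mono fun a₁ => iInf_mono fun _ => ?_
  gcongr

theorem eq_zero_of_K_eq_zero (B : InterpolationCouple 𝕜 B₀ B₁ V) {t : ℝ} (ht : 0 < t) {a : V}
    (h : B.K t a = 0) : a = 0 := by
  have key : ∀ n : ℕ, ∃ (a₀ : B₀) (a₁ : B₁), B.j₀ a₀ + B.j₁ a₁ = a ∧
      ‖a₀‖ ≤ 1 / ((n : ℝ) + 1) ∧ ‖a₁‖ ≤ (1 / ((n : ℝ) + 1)) / t := by
    intro n
    have hn : (0 : ℝ) < 1 / ((n : ℝ) + 1) := by positivity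
    have hlt : B.K t a < ENNReal.ofReal (1 / ((n : ℝ) + 1)) := by
      rw [h]; exact ENNReal.ofReal_pos.2 hn
    simp only [K, iInf_lt_iff] at hlt
    obtain ⟨a₀, a₁, ha, hlt⟩ := hlt
    rw [← ENNReal.ofReal_mul ht.le, ← ENNReal.ofReal_add (norm_nonneg _) (by positivity),
      ENNReal.ofReal_lt_ofReal_iff hn] at hlt
    have h0 := norm_nonneg a₀
    have h1 : 0 ≤ t * ‖a₁‖ := by positivity
    refine ⟨a₀, a₁, ha, by linarith, ?_⟩
    rw [le_div_iff₀ ht]; linarith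
  choose a₀ a₁ ha h₀ h₁ using key
  have t₀ : Tendsto a₀ atTop (𝓝 0) :=
    squeeze_zero_norm h₀ tendsto_one_div_add_atTop_nhds_zero_nat
  have t₁ : Tendsto a₁ atTop (𝓝 0) := by
    refine squeeze_zero_norm h₁ ?_
    simpa using (tendsto_one_div_add_atTop_nhds_zero_nat (𝕜 := ℝ)).div_const t
  have l := ((B.j₀.continuous.tendsto 0).comp t₀).add ((B.j₁.continuous.tendsto 0).comp t₁)
  simp only [map_zero, add_zero, Function.comp_def, ha] at l
  exact tendsto_nhds_unique tendsto_const_nhds l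

theorem measurable_integrand (B : InterpolationCouple 𝕜 B₀ B₁ V) (θ : ℝ) (a : V) :
    Measurable fun t : ℝ => B.K t a / ENNReal.ofReal (t ^ θ) :=
  (B.K_mono a).measurable.div (ENNReal.measurable_ofReal.comp (measurable_id.pow_const θ))

/-- `eNorm` as an `L^p` norm for the measure `dt/t` on `(0, ∞)`. -/
theorem eNorm_eq (B : InterpolationCouple 𝕜 B₀ B₁ V) (θ p : ℝ) (a : V) :
    B.eNorm θ p a = (∫⁻ t, (B.K t a / ENNReal.ofReal (t ^ θ)) ^ p
      ∂((volume.restrict (Ioi (0 : ℝ))).withDensity fun t => (ENNReal.ofReal t)⁻¹)) ^ (1 / p) := by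
  have hm : Measurable fun t : ℝ => (ENNReal.ofReal t)⁻¹ := ENNReal.measurable_ofReal.inv
  rw [lintegral_withDensity_eq_lintegral_mul _ hm ((B.measurable_integrand θ a).pow_const p)]
  simp only [eNorm, Pi.mul_apply, div_eq_mul_inv, mul_comm]

theorem eNorm_zero (B : InterpolationCouple 𝕜 B₀ B₁ V) (θ : ℝ) {p : ℝ} (hp : 1 < p) :
    B.eNorm θ p 0 = 0 := by
  have h : 0 < p := by linarith
  simp [eNorm, K_zero, ENNReal.zero_rpow_of_pos h, h]

theorem eNorm_add_le (B : InterpolationCouple 𝕜 B₀ B₁ V) (θ : ℝ) {p : ℝ} (hp : 1 < p) (a b : V) :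
    B.eNorm θ p (a + b) ≤ B.eNorm θ p a + B.eNorm θ p b := by
  simp only [eNorm_eq]
  refine le_trans ?_ (ENNReal.lintegral_Lp_add_le (B.measurable_integrand θ a).aemeasurable
    (B.measurable_integrand θ b).aemeasurable hp.le)
  have h : 0 ≤ p := by linarith
  refine ENNReal.rpow_le_rpow (lintegral_mono fun t => ?_) (by positivity)
  refine ENNReal.rpow_le_rpow ?_ h
  simp only [Pi.add_apply, ← ENNReal.add_div]
  gcongr
  exact B.K_add_le t a b

theorem eNorm_smul_le (B : InterpolationCouple 𝕜 B₀ B₁ V) (θ : ℝ) {p : ℝ} (hp : 1 < p) (c : 𝕜)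
    (a : V) : B.eNorm θ p (c • a) ≤ ‖c‖ₑ * B.eNorm θ p a := by
  have h : 0 < p := by linarith
  have e : ‖c‖ₑ = (‖c‖ₑ ^ p) ^ (1 / p) := by
    rw [← ENNReal.rpow_mul, mul_one_div_cancel h.ne', ENNReal.rpow_one]
  rw [e, eNorm_eq, eNorm_eq, ← ENNReal.mul_rpow_of_nonneg _ _ (by positivity),
    ← lintegral_const_mul _ ((B.measurable_integrand θ a).pow_const p)]
  refine ENNReal.rpow_le_rpow (lintegral_mono fun t => ?_) (by positivity)
  rw [← ENNReal.mul_rpow_of_nonneg _ _ h.le]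
  refine ENNReal.rpow_le_rpow ?_ h.le
  rw [← mul_div_assoc]
  gcongr
  exact B.K_smul_le t c a

theorem eq_zero_of_eNorm_eq_zero (B : InterpolationCouple 𝕜 B₀ B₁ V) (θ : ℝ) {p : ℝ}
    (hp : 1 < p) {a : V} (h : B.eNorm θ p a = 0) : a = 0 := by
  have hp0 : 0 < p := by linarith
  have hm : Measurable fun t : ℝ =>
      (B.K t a / ENNReal.ofReal (t ^ θ)) ^ p / ENNReal.ofReal t :=
    ((B.measurable_integrand θ a).pow_const p).div ENNReal.measurable_ofReal
  rw [eNorm, ENNReal.rpow_eq_zero_iff_of_pos (by positivity), lintegral_eq_zero_iff hm] at h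
  have h2 := (ae_restrict_iff' measurableSet_Ioi).1 h
  obtain ⟨t, ht, ht'⟩ : ∃ t : ℝ, 0 < t ∧
      (B.K t a / ENNReal.ofReal (t ^ θ)) ^ p / ENNReal.ofReal t = 0 := by
    by_contra! hcon
    have hsub : Ioi (0 : ℝ) ⊆ {t | ¬ (t ∈ Ioi (0 : ℝ) →
        (fun t : ℝ => (B.K t a / ENNReal.ofReal (t ^ θ)) ^ p / ENNReal.ofReal t) t
          = (0 : ℝ → ℝ≥0∞) t)} := by
      intro t ht
      simp only [mem_ofPred_eq, not_forall]
      exact ⟨ht, hcon t ht⟩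
    have h0 := measure_mono_null hsub (ae_iff.1 h2)
    simp at h0
  refine B.eq_zero_of_K_eq_zero ht ?_
  rw [ENNReal.div_eq_zero_iff, or_iff_left ENNReal.ofReal_ne_top,
    ENNReal.rpow_eq_zero_iff_of_pos hp0, ENNReal.div_eq_zero_iff,
    or_iff_left ENNReal.ofReal_ne_top] at ht'
  exact ht'

/-- The real interpolation space `B_{θ,p}` as a linear subspace of `V`: all `a ∈ B₀ + B₁` with
`(∫₀^∞ (t^(-θ) K(t, a))^p dt/t)^(1/p) < ∞`. -/
noncomputable def realSubmodule (B : InterpolationCouple 𝕜 B₀ B₁ V) (θ p : ℝ) (hp : 1 < p) :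
    Submodule 𝕜 V where
  carrier := {a | (∃ (a₀ : B₀) (a₁ : B₁), a = B.j₀ a₀ + B.j₁ a₁) ∧ B.eNorm θ p a < ⊤}
  zero_mem' := ⟨⟨0, 0, by simp⟩, by simp [B.eNorm_zero θ hp]⟩
  add_mem' := by
    rintro _ _ ⟨⟨a₀, a₁, rfl⟩, ha⟩ ⟨⟨b₀, b₁, rfl⟩, hb⟩
    refine ⟨⟨a₀ + b₀, a₁ + b₁, by rw [map_add, map_add]; abel⟩, ?_⟩
    exact (B.eNorm_add_le θ hp _ _).trans_lt (ENNReal.add_lt_top.2 ⟨ha, hb⟩)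
  smul_mem' := by
    rintro c _ ⟨⟨a₀, a₁, rfl⟩, ha⟩
    refine ⟨⟨c • a₀, c • a₁, by rw [map_smul, map_smul, smul_add]⟩, ?_⟩
    exact (B.eNorm_smul_le θ hp _ _).trans_lt (ENNReal.mul_lt_top enorm_lt_top ha)

/-- The real interpolation space `B_{θ,p}` as a type of its own, so that it carries its own norm
topology and not the one induced from `V`. -/
def RealInterp (B : InterpolationCouple 𝕜 B₀ B₁ V) (θ p : ℝ) (hp : 1 < p) : Type _ :=
  B.realSubmodule θ p hp

noncomputable instance (B : InterpolationCouple 𝕜 B₀ B₁ V) (θ p : ℝ) (hp : 1 < p) :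
    AddCommGroup (B.RealInterp θ p hp) :=
  inferInstanceAs (AddCommGroup (B.realSubmodule θ p hp))

noncomputable instance (B : InterpolationCouple 𝕜 B₀ B₁ V) (θ p : ℝ) (hp : 1 < p) :
    Module 𝕜 (B.RealInterp θ p hp) :=
  inferInstanceAs (Module 𝕜 (B.realSubmodule θ p hp))

/-- The inclusion of `B_{θ,p}` in the ambient space. -/
noncomputable def incl (B : InterpolationCouple 𝕜 B₀ B₁ V) (θ p : ℝ) (hp : 1 < p) :
    B.RealInterp θ p hp →ₗ[𝕜] V :=
  (B.realSubmodule θ p hp).subtype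

noncomputable instance (B : InterpolationCouple 𝕜 B₀ B₁ V) (θ p : ℝ) (hp : 1 < p) :
    Norm (B.RealInterp θ p hp) :=
  ⟨fun a => (B.eNorm θ p (B.incl θ p hp a)).toReal⟩

theorem norm_def (B : InterpolationCouple 𝕜 B₀ B₁ V) (θ p : ℝ) (hp : 1 < p)
    (a : B.RealInterp θ p hp) : ‖a‖ = (B.eNorm θ p (B.incl θ p hp a)).toReal := rfl

theorem eNorm_incl_ne_top (B : InterpolationCouple 𝕜 B₀ B₁ V) (θ p : ℝ) (hp : 1 < p)
    (a : B.RealInterp θ p hp) : B.eNorm θ p (B.incl θ p hp a) ≠ ⊤ :=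
  (Subtype.prop (p := fun v => v ∈ B.realSubmodule θ p hp) a).2.ne

theorem norm_smul_le_aux (B : InterpolationCouple 𝕜 B₀ B₁ V) (θ p : ℝ) (hp : 1 < p) (c : 𝕜)
    (a : B.RealInterp θ p hp) : ‖c • a‖ ≤ ‖c‖ * ‖a‖ := by
  have h := ENNReal.toReal_mono
    (ENNReal.mul_ne_top enorm_ne_top (B.eNorm_incl_ne_top θ p hp a))
    (B.eNorm_smul_le θ hp c (B.incl θ p hp a))
  rw [ENNReal.toReal_mul, toReal_enorm] at h
  rw [norm_def, norm_def, map_smul]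
  exact h

theorem normCore (B : InterpolationCouple 𝕜 B₀ B₁ V) (θ p : ℝ) (hp : 1 < p) :
    NormedSpace.Core 𝕜 (B.RealInterp θ p hp) where
  norm_nonneg _ := ENNReal.toReal_nonneg
  norm_smul c a := by
    refine le_antisymm (B.norm_smul_le_aux θ p hp c a) ?_
    by_cases hc : c = 0
    · subst hc
      rw [norm_zero, zero_mul]
      exact ENNReal.toReal_nonneg
    have h := B.norm_smul_le_aux θ p hp c⁻¹ (c • a)
    rw [inv_smul_smul₀ hc, norm_inv] at h
    have hc' : 0 < ‖c‖ := norm_pos_iff.2 hc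
    calc ‖c‖ * ‖a‖ ≤ ‖c‖ * (‖c‖⁻¹ * ‖c • a‖) := by gcongr
      _ = ‖c • a‖ := by rw [mul_inv_cancel_left₀ hc'.ne']
  norm_triangle a b := by
    have h := ENNReal.toReal_mono
      (ENNReal.add_ne_top.2 ⟨B.eNorm_incl_ne_top θ p hp a, B.eNorm_incl_ne_top θ p hp b⟩)
      (B.eNorm_add_le θ hp (B.incl θ p hp a) (B.incl θ p hp b))
    rw [ENNReal.toReal_add (B.eNorm_incl_ne_top θ p hp a) (B.eNorm_incl_ne_top θ p hp b)] at h
    rw [norm_def, norm_def, norm_def, map_add]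
    exact h
  norm_eq_zero_iff a := by
    rw [norm_def, ENNReal.toReal_eq_zero_iff, or_iff_left (B.eNorm_incl_ne_top θ p hp a)]
    constructor
    · intro h
      have h0 := B.eq_zero_of_eNorm_eq_zero θ hp h
      exact Subtype.ext h0
    · rintro rfl
      rw [map_zero, B.eNorm_zero θ hp]

/-- `B_{θ,p}` with the norm `(∫₀^∞ (t^(-θ) K(t, a))^p dt/t)^(1/p)`. -/
noncomputable instance (B : InterpolationCouple 𝕜 B₀ B₁ V) (θ p : ℝ) (hp : 1 < p) :
    NormedAddCommGroup (B.RealInterp θ p hp) :=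
  NormedAddCommGroup.ofCore (B.normCore θ p hp)

noncomputable instance (B : InterpolationCouple 𝕜 B₀ B₁ V) (θ p : ℝ) (hp : 1 < p) :
    NormedSpace 𝕜 (B.RealInterp θ p hp) :=
  NormedSpace.ofCore (B.normCore θ p hp)

end InterpolationCouple

/-!
The equivalent norm is the discrete `K`-method norm built from `ℓ^p` decompositions. For `k ∈ ℤ`
give `B₀ + B₁` the norm
`N_k(a) = 2 ^ (-θ k) inf (‖a₀‖ ^ p + (2 ^ k ‖a₁‖) ^ p) ^ (1 / p)`, the infimum being over all
`a = a₀ + a₁`. It is the quotient norm of `SumSpace` and is comparable with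
`2 ^ (-θ k) K(2 ^ k, a)`. Since `K(t, a)` is monotone in `t`, cutting the integral at the powers
of two shows that `N(a) = (∑ N_k(a) ^ p) ^ (1 / p)` is equivalent to the norm of `B_{θ,p}`
(`norm_toLp_le`, `norm_le_norm_toLp`). In other words, `toLp` embeds `B_{θ,p}` diagonally in the
`ℓ^p` sum of the spaces `(B₀ + B₁, N_k)`.

Let `N(x_n) = N(y_n) = 1` and `N(x_n + y_n) → 2`. The convexity defects
`(N_k(x_n) ^ p + N_k(y_n) ^ p) / 2 - (N_k(x_n + y_n) / 2) ^ p` are nonnegative and their sum over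
`k` tends to zero, so each of them does. For near-optimal decompositions in the norm `N_m` the
defect dominates, up to an error tending to zero, the defect of the `B₀` parts. A compactness
argument with the strict convexity of `s ↦ s ^ p` reduces this situation to the definition of weak
uniform rotundity (`IsWUR.tendsto_apply_sub`), so the difference of the `B₀` parts is weakly null
in `B₀`. The `B₁` parts have norm `O(2 ^ (-(1 - θ) m))`. Letting `m → ∞` shows that `x_n - y_n` is
weakly null in `B₀ + B₁`, that is, in every coordinate of the `ℓ^p` sum
(`tendsto_apply_toDyadicSum_sub`).

A functional on `B_{θ,p}` extends to the `ℓ^p` sum by the Hahn–Banach theorem, and as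
`1 < p < ∞` it is small on vectors vanishing on a large finite set of coordinates
(`lp.exists_finset_norm_apply_le`). Hence coordinatewise weak convergence of a bounded sequence
is weak convergence, and `x_n - y_n` is weakly null in `B_{θ,p}`. No duality theorem for
interpolation spaces is needed.
-/

/-! ### Weakly uniformly rotund norms and convexity defects -/

section Weak
variable {𝕜 X : Type*} [RCLike 𝕜] [NormedAddCommGroup X] [NormedSpace 𝕜 X]

theorem tendsto_toWeakSpace_zero_iff {x : ℕ → X} :
    Tendsto (fun n => toWeakSpace 𝕜 X (x n)) atTop (𝓝 0) ↔
      ∀ f : StrongDual 𝕜 X, Tendsto (fun n => f (x n)) atTop (𝓝 0) := by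
  have hinj : Function.Injective ((topDualPairing 𝕜 X).flip) := by
    intro a b hab
    by_contra hne
    obtain ⟨f, hf⟩ := SeparatingDual.exists_ne_zero (R := 𝕜) (sub_ne_zero.2 hne)
    apply hf
    rw [map_sub, sub_eq_zero]
    exact LinearMap.congr_fun hab f
  have := WeakBilin.tendsto_iff_forall_eval_tendsto (l := atTop) (topDualPairing 𝕜 X).flip
    (f := fun n => toWeakSpace 𝕜 X (x n)) (x := (0 : WeakSpace 𝕜 X)) hinj
  refine this.trans (forall_congr' fun f => ?_)
  change Tendsto (fun n => f (x n)) atTop (𝓝 (f 0)) ↔ _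
  rw [map_zero]

/-- The case of nonzero vectors whose norms have a common positive limit: it reduces to the
definition by normalizing. -/
theorem IsWUR.tendsto_apply_sub_of_norm_tendsto (h : IsWUR (normSeminorm 𝕜 X)) {a b : ℕ → X}
    {α : ℝ} (hα : 0 < α) (ha0 : ∀ n, a n ≠ 0) (hb0 : ∀ n, b n ≠ 0)
    (ha : Tendsto (fun n => ‖a n‖) atTop (𝓝 α)) (hb : Tendsto (fun n => ‖b n‖) atTop (𝓝 α))
    (hab : Tendsto (fun n => ‖a n + b n‖) atTop (𝓝 (2 * α))) (f : StrongDual 𝕜 X) :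
    Tendsto (fun n => f (a n - b n)) atTop (𝓝 0) := by
  set x : ℕ → X := fun n => ((‖a n‖ : 𝕜)⁻¹) • a n with hx
  set y : ℕ → X := fun n => ((‖b n‖ : 𝕜)⁻¹) • b n with hy
  have hx1 : ∀ n, ‖x n‖ = 1 := fun n => norm_smul_inv_norm (ha0 n)
  have hy1 : ∀ n, ‖y n‖ = 1 := fun n => norm_smul_inv_norm (hb0 n)
  have hax : ∀ n, a n = (‖a n‖ : 𝕜) • x n := fun n => by
    rw [hx]; simp only; rw [smul_inv_smul₀]; simpa using ha0 n
  have hby : ∀ n, b n = (‖b n‖ : 𝕜) • y n := fun n => by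
    rw [hy]; simp only; rw [smul_inv_smul₀]; simpa using hb0 n
  have hdiff : Tendsto (fun n => ‖a n‖ - ‖b n‖) atTop (𝓝 0) := by simpa using ha.sub hb
  have hsum : Tendsto (fun n => ‖x n + y n‖) atTop (𝓝 2) := by
    have hlow : Tendsto (fun n => (‖a n + b n‖ - |‖a n‖ - ‖b n‖|) / ‖a n‖) atTop (𝓝 2) := by
      have := (hab.sub hdiff.abs).div ha hα.ne'
      rwa [abs_zero, sub_zero, mul_div_assoc, div_self hα.ne', mul_one] at this
    refine tendsto_of_tendsto_of_tendsto_of_le_of_le hlow tendsto_const_nhds (fun n => ?_)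
      (fun n => ?_)
    · have hpos : 0 < ‖a n‖ := norm_pos_iff.2 (ha0 n)
      simp only
      rw [div_le_iff₀ hpos, sub_le_iff_le_add]
      have e : a n + b n = (‖a n‖ : 𝕜) • (x n + y n) - ((‖a n‖ - ‖b n‖ : ℝ) : 𝕜) • y n := by
        conv_lhs => rw [hax n, hby n]
        push_cast
        module
      calc ‖a n + b n‖ ≤ ‖(‖a n‖ : 𝕜) • (x n + y n)‖ + ‖((‖a n‖ - ‖b n‖ : ℝ) : 𝕜) • y n‖ := by
            conv_lhs => rw [e]
            exact norm_sub_le _ _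
        _ = ‖x n + y n‖ * ‖a n‖ + |‖a n‖ - ‖b n‖| := by
            rw [norm_smul, norm_smul, hy1, RCLike.norm_ofReal, RCLike.norm_ofReal, abs_norm,
              mul_one, mul_comm]
    · calc ‖x n + y n‖ ≤ ‖x n‖ + ‖y n‖ := norm_add_le _ _
        _ = 2 := by rw [hx1, hy1]; norm_num
  have hw := tendsto_toWeakSpace_zero_iff.1 (h x y hx1 hy1 hsum) f
  have hfy : Tendsto (fun n => ((‖a n‖ - ‖b n‖ : ℝ) : 𝕜) * f (y n)) atTop (𝓝 0) := by
    refine squeeze_zero_norm (a := fun n => |‖a n‖ - ‖b n‖| * ‖f‖) (fun n => ?_) ?_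
    · rw [norm_mul, RCLike.norm_ofReal]
      gcongr
      simpa [hy1] using f.le_opNorm (y n)
    · simpa using hdiff.abs.mul_const ‖f‖
  have hl := (((RCLike.continuous_ofReal (K := 𝕜)).tendsto α).comp ha).mul hw |>.add hfy
  rw [mul_zero, add_zero] at hl
  refine hl.congr fun n => ?_
  have e : a n - b n = (‖a n‖ : 𝕜) • (x n - y n) + ((‖a n‖ - ‖b n‖ : ℝ) : 𝕜) • y n := by
    conv_lhs => rw [hax n, hby n]
    push_cast
    module
  rw [e, map_add, f.map_smul _ (x n - y n), f.map_smul _ (y n)]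
  rfl

theorem add_div_two_rpow_le {p : ℝ} (hp : 1 < p) {s t : ℝ} (hs : 0 ≤ s) (ht : 0 ≤ t) :
    ((s + t) / 2) ^ p ≤ (s ^ p + t ^ p) / 2 := by
  have := (convexOn_rpow hp.le).2 (mem_Ici.2 hs) (mem_Ici.2 ht)
    (by norm_num : (0 : ℝ) ≤ 1 / 2) (by norm_num : (0 : ℝ) ≤ 1 / 2) (by norm_num)
  simp only [smul_eq_mul] at this
  rw [show (s + t) / 2 = 1 / 2 * s + 1 / 2 * t by ring]
  linarith

theorem norm_add_div_two_rpow_le {Y : Type*} [SeminormedAddCommGroup Y] {p : ℝ} (hp : 1 < p)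
    (a b : Y) : (‖a + b‖ / 2) ^ p ≤ (‖a‖ ^ p + ‖b‖ ^ p) / 2 := by
  refine le_trans ?_ (add_div_two_rpow_le hp (norm_nonneg a) (norm_nonneg b))
  gcongr
  exact norm_add_le a b

/-- Bounded sequences along which the convexity inequality for `‖·‖ ^ p` becomes an equality in
the limit have weakly null difference, if the norm is weakly uniformly rotund. -/
theorem IsWUR.tendsto_apply_sub (h : IsWUR (normSeminorm 𝕜 X)) {p : ℝ} (hp : 1 < p)
    {a b : ℕ → X} {M : ℝ} (ha : ∀ n, ‖a n‖ ≤ M) (hb : ∀ n, ‖b n‖ ≤ M)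
    (hD : Tendsto (fun n => (‖a n‖ ^ p + ‖b n‖ ^ p) / 2 - (‖a n + b n‖ / 2) ^ p) atTop (𝓝 0))
    (f : StrongDual 𝕜 X) : Tendsto (fun n => f (a n - b n)) atTop (𝓝 0) := by
  have hp0 : 0 < p := by linarith
  refine tendsto_of_subseq_tendsto fun ns hns => ?_
  -- along a subsequence the norms converge
  obtain ⟨⟨α, β, γ⟩, ⟨hα, hβ, hγ⟩, φ, hφ, hlim⟩ :=
    ((isCompact_Icc (a := (0 : ℝ)) (b := M)).prod
      ((isCompact_Icc (a := (0 : ℝ)) (b := M)).prod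
        (isCompact_Icc (a := (0 : ℝ)) (b := M + M)))).tendsto_subseq
      (x := fun n => (‖a (ns n)‖, ‖b (ns n)‖, ‖a (ns n) + b (ns n)‖))
      (fun n => ⟨⟨norm_nonneg _, ha _⟩, ⟨norm_nonneg _, hb _⟩, norm_nonneg _,
        (norm_add_le _ _).trans (add_le_add (ha _) (hb _))⟩)
  rw [nhds_prod_eq, nhds_prod_eq, tendsto_prod_iff', tendsto_prod_iff'] at hlim
  obtain ⟨h1, h2, h3⟩ := hlim
  simp only [Function.comp_def] at h1 h2 h3
  simp only [mem_Icc] at hα hβ hγ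
  have hD' := hD.comp (hns.comp hφ.tendsto_atTop)
  have hlimD := (((h1.rpow_const (Or.inr hp0.le)).add (h2.rpow_const (Or.inr hp0.le))).div_const
    2).sub ((h3.div_const 2).rpow_const (p := p) (Or.inr hp0.le))
  have heq : (α ^ p + β ^ p) / 2 - (γ / 2) ^ p = 0 := tendsto_nhds_unique hlimD hD'
  have hγ' : γ ≤ α + β := le_of_tendsto_of_tendsto' h3 (h1.add h2) fun n => norm_add_le _ _
  have hle : (γ / 2) ^ p ≤ ((α + β) / 2) ^ p :=
    Real.rpow_le_rpow (by linarith) (by linarith) hp0.le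
  have hαβ : α = β := by
    by_contra hne
    have := (strictConvexOn_rpow hp).2 (mem_Ici.2 hα.1) (mem_Ici.2 hβ.1) hne
      (by norm_num : (0 : ℝ) < 1 / 2) (by norm_num : (0 : ℝ) < 1 / 2) (by norm_num)
    simp only [smul_eq_mul] at this
    rw [show 1 / 2 * α + 1 / 2 * β = (α + β) / 2 by ring] at this
    linarith
  subst hαβ
  have hγα : γ = 2 * α := by
    have h5 : α ^ p ≤ (γ / 2) ^ p := by linarith
    have := (Real.rpow_le_rpow_iff hα.1 (by linarith) hp0).1 h5
    linarith
  subst hγα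
  refine ⟨φ, ?_⟩
  rcases hα.1.eq_or_lt with h0 | hpos
  · subst h0
    refine squeeze_zero_norm (a := fun n => ‖f‖ * (‖a (ns (φ n))‖ + ‖b (ns (φ n))‖))
      (fun n => ?_) ?_
    · refine (f.le_opNorm _).trans ?_
      gcongr
      exact norm_sub_le _ _
    · simpa using (h1.add h2).const_mul ‖f‖
  · obtain ⟨m, hm⟩ := eventually_atTop.1
      ((h1.eventually_const_lt hpos).and (h2.eventually_const_lt hpos))
    refine (tendsto_add_atTop_iff_nat m).1 ?_
    exact h.tendsto_apply_sub_of_norm_tendsto hpos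
      (a := fun n => a (ns (φ (n + m)))) (b := fun n => b (ns (φ (n + m))))
      (fun n => norm_pos_iff.1 (hm (n + m) (by omega)).1)
      (fun n => norm_pos_iff.1 (hm (n + m) (by omega)).2)
      ((tendsto_add_atTop_iff_nat m).2 h1) ((tendsto_add_atTop_iff_nat m).2 h2)
      ((tendsto_add_atTop_iff_nat m).2 h3) f

end Weak

/-! ### Weak convergence in `ℓ^q` sums -/

section LpTail
variable {𝕜 ι : Type*} {X : ι → Type*} [RCLike 𝕜] [∀ i, NormedAddCommGroup (X i)]
  [∀ i, NormedSpace 𝕜 (X i)] {q : ℝ≥0∞}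

theorem lp.norm_add_rpow_of_disjoint_support (hq : 0 < q.toReal) {T : Set ι} {w u : lp X q}
    (hw : ∀ i ∉ T, w i = 0) (hu : ∀ i ∈ T, u i = 0) :
    ‖w + u‖ ^ q.toReal = ‖w‖ ^ q.toReal + ‖u‖ ^ q.toReal := by
  refine (lp.hasSum_norm hq (w + u)).unique ?_
  convert (lp.hasSum_norm hq w).add (lp.hasSum_norm hq u) using 2 with i
  rw [lp.coeFn_add, Pi.add_apply]
  by_cases hi : i ∈ T
  · rw [hu i hi, add_zero, norm_eq_zero.2 rfl, Real.zero_rpow hq.ne', add_zero]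
  · rw [hw i hi, zero_add, norm_eq_zero.2 rfl, Real.zero_rpow hq.ne', zero_add]

variable [Fact (1 ≤ q)]

/-- A continuous functional on `ℓ^q(X)` with `1 < q < ∞` is small on the elements supported off a
suitable finite set. -/
theorem lp.exists_finset_norm_apply_le (hq : 1 < q.toReal) (hq' : q ≠ ∞)
    (G : StrongDual 𝕜 (lp X q)) {ε : ℝ} (hε : 0 < ε) :
    ∃ T : Finset ι, ∀ z : lp X q, (∀ i ∈ T, z i = 0) → ‖G z‖ ≤ ε * ‖z‖ := by
  classical
  set p := q.toReal with hp
  have hp0 : 0 < p := by linarith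
  -- The gain of `G` from adding a far-away vector of norm `s` is of order `s`, while its cost in
  -- the norm is of order `s ^ p`; this is where `p > 1` enters.
  obtain ⟨s, hs, hsG⟩ : ∃ s : ℝ, 0 < s ∧ ‖G‖ * s ^ (p - 1) ≤ ε / 2 := by
    have hc : Tendsto (fun s : ℝ => ‖G‖ * s ^ (p - 1)) (𝓝[>] 0) (𝓝 (‖G‖ * 0 ^ (p - 1))) :=
      (((Real.continuousAt_rpow_const 0 (p - 1) (Or.inr (by linarith))).tendsto).const_mul
        ‖G‖).mono_left nhdsWithin_le_nhds
    rw [Real.zero_rpow (by linarith), mul_zero] at hc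
    obtain ⟨s, hs1, hs2⟩ := ((hc.eventually_le_const (half_pos hε)).and
      self_mem_nhdsWithin).exists
    exact ⟨s, hs2, hs1⟩
  set δ := ε * s / 2 with hδ
  have hδ0 : 0 < δ := by positivity
  -- a finitely supported vector at which `G` almost attains its norm
  obtain ⟨w, T, hwT, hw1, hGw⟩ : ∃ (w : lp X q) (T : Finset ι), (∀ i ∉ T, w i = 0) ∧ ‖w‖ ≤ 1 ∧
      ‖G‖ - δ < ‖G w‖ := by
    obtain ⟨x, hx1, hGx⟩ := G.exists_lt_apply_of_lt_opNorm (sub_lt_self ‖G‖ hδ0)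
    have hlim : Tendsto (fun T : Finset ι => ‖G (∑ i ∈ T, lp.single q i (x i))‖) atTop
        (𝓝 ‖G x‖) := ((G.continuous.tendsto x).comp (lp.hasSum_single hq' x)).norm
    obtain ⟨T, hT⟩ := (hlim.eventually_const_lt hGx).exists
    refine ⟨_, T, fun i hi => ?_, ?_, hT⟩
    · rw [lp.coeFn_sum, Finset.sum_apply]
      exact Finset.sum_eq_zero fun j hj => lp.single_apply_ne _ _ _ (by rintro rfl; exact hi hj)
    · refine le_trans ?_ hx1.le
      rw [← Real.rpow_le_rpow_iff (norm_nonneg _) (norm_nonneg _) hp0, hp,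
        lp.norm_sum_single (hp ▸ hp0)]
      exact lp.sum_rpow_le_norm_rpow (hp ▸ hp0) x T
  refine ⟨T, fun z hz => ?_⟩
  rcases eq_or_ne z 0 with rfl | hz0
  · simp
  have hzpos : 0 < ‖z‖ := norm_pos_iff.2 hz0
  obtain ⟨c, hc1, hc⟩ := RCLike.exists_norm_eq_mul_self (G w)
  obtain ⟨d, hd1, hd⟩ := RCLike.exists_norm_eq_mul_self (G z)
  set r : ℝ := s / ‖z‖ with hr
  have hr0 : 0 < r := by positivity
  -- phases are chosen so that `G` does not cancel on the sum
  set u : lp X q := ((r : 𝕜) * d) • z with hu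
  have hun : ‖u‖ = s := by
    rw [hu, norm_smul, norm_mul, hd1, RCLike.norm_ofReal, abs_of_pos hr0, mul_one, hr,
      div_mul_cancel₀ _ hzpos.ne']
  have hsum : ‖c • w + u‖ ≤ 1 + s ^ p := by
    have h1 : ‖c • w + u‖ ^ p ≤ 1 + s ^ p := by
      rw [lp.norm_add_rpow_of_disjoint_support (T := (T : Set ι)) (hp ▸ hp0)
        (fun i hi => by rw [lp.coeFn_smul, Pi.smul_apply, hwT i (by simpa using hi), smul_zero])
        (fun i hi => by rw [lp.coeFn_smul, Pi.smul_apply, hz i (by simpa using hi), smul_zero]),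
        hun, norm_smul, hc1, one_mul]
      gcongr
      exact Real.rpow_le_one (norm_nonneg _) hw1 hp0.le
    have hs1 : 1 ≤ 1 + s ^ p := by have := Real.rpow_nonneg hs.le p; linarith
    rw [← Real.rpow_le_rpow_iff (norm_nonneg _) (by linarith) hp0]
    refine h1.trans ?_
    exact Real.self_le_rpow_of_one_le hs1 hq.le
  have hG : ‖G w‖ + r * ‖G z‖ ≤ ‖G‖ * (1 + s ^ p) := by
    refine le_trans (le_of_eq ?_) ((G.le_opNorm (c • w + u)).trans (by gcongr))
    have : G (c • w + u) = ((‖G w‖ + r * ‖G z‖ : ℝ) : 𝕜) := by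
      rw [map_add, hu, map_smul, map_smul, smul_eq_mul, smul_eq_mul, mul_assoc, ← hc, ← hd]
      push_cast; rfl
    rw [this, RCLike.norm_ofReal, abs_of_nonneg (by positivity)]
  have hsp : s ^ p = s ^ (p - 1) * s := by
    rw [← Real.rpow_add_one hs.ne']; ring_nf
  have h2 : r * ‖G z‖ ≤ ε * s := by
    calc r * ‖G z‖ ≤ ‖G‖ * s ^ (p - 1) * s + δ := by rw [hsp] at hG; linarith
      _ ≤ ε / 2 * s + δ := by gcongr
      _ = ε * s := by rw [hδ]; ring
  rw [hr, div_mul_eq_mul_div, div_le_iff₀ hzpos] at h2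
  have h3 : s * ‖G z‖ ≤ s * (ε * ‖z‖) := by linarith
  exact le_of_mul_le_mul_left h3 hs

/-- In `ℓ^q(X)` with `1 < q < ∞`, a bounded sequence with weakly null coordinates is weakly
null. -/
theorem lp.tendsto_apply_of_forall_tendsto (hq : 1 < q.toReal) (hq' : q ≠ ∞) {z : ℕ → lp X q}
    {M : ℝ} (hM : ∀ n, ‖z n‖ ≤ M)
    (hz : ∀ i, ∀ g : StrongDual 𝕜 (X i), Tendsto (fun n => g (z n i)) atTop (𝓝 0))
    (G : StrongDual 𝕜 (lp X q)) : Tendsto (fun n => G (z n)) atTop (𝓝 0) := by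
  classical
  have hq0 : 0 < q.toReal := by linarith
  have hM0 : 0 ≤ M := (norm_nonneg _).trans (hM 0)
  refine Metric.tendsto_atTop.2 fun ε hε => ?_
  obtain ⟨T, hT⟩ := lp.exists_finset_norm_apply_le hq hq' G
    (ε := ε / (2 * (M + 1))) (by positivity)
  have hfin : Tendsto (fun n => G (∑ i ∈ T, lp.single q i (z n i))) atTop (𝓝 0) := by
    simp only [map_sum]
    rw [← Finset.sum_const_zero (s := T)]
    exact tendsto_finsetSum T fun i _ =>
      hz i (G.comp (lp.singleContinuousLinearMap 𝕜 X q i))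
  obtain ⟨n₀, hn₀⟩ := Metric.tendsto_atTop.1 hfin (ε / 2) (by positivity)
  refine ⟨n₀, fun n hn => ?_⟩
  set w := ∑ i ∈ T, lp.single q i (z n i) with hw
  have h1 := hn₀ n hn
  rw [dist_zero_right] at h1 ⊢
  have hr : ‖z n - w‖ ≤ M := by
    refine le_trans ?_ (hM n)
    rw [← Real.rpow_le_rpow_iff (norm_nonneg _) (norm_nonneg _) hq0, hw,
      lp.norm_compl_sum_single hq0, sub_le_self_iff]
    exact Finset.sum_nonneg fun i _ => by positivity
  have h2 : ‖G (z n - w)‖ < ε / 2 := by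
    refine (hT (z n - w) fun i hi => ?_).trans_lt ?_
    · rw [lp.coeFn_sub, Pi.sub_apply, hw, lp.coeFn_sum, Finset.sum_apply,
        Finset.sum_eq_single i (fun j _ hj => lp.single_apply_ne _ _ _ hj.symm)
          (fun h => absurd hi h), lp.single_apply_self, sub_self]
    · calc ε / (2 * (M + 1)) * ‖z n - w‖ ≤ ε / (2 * (M + 1)) * M := by gcongr
        _ < ε / (2 * (M + 1)) * (M + 1) := by gcongr; linarith
        _ = ε / 2 := by field_simp
  calc ‖G (z n)‖ = ‖G w + G (z n - w)‖ := by rw [← map_add, add_sub_cancel]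
    _ ≤ ‖G w‖ + ‖G (z n - w)‖ := norm_add_le _ _
    _ < ε := by linarith

end LpTail

/-- Functionals extend along a linear map that is bounded below. -/
theorem exists_strongDual_apply_eq {𝕜 E Y : Type*} [RCLike 𝕜] [NormedAddCommGroup E]
    [NormedSpace 𝕜 E] [NormedAddCommGroup Y] [NormedSpace 𝕜 Y] (j : E →ₗ[𝕜] Y) {C : ℝ}
    (hj : ∀ a, ‖a‖ ≤ C * ‖j a‖) (F : StrongDual 𝕜 E) :
    ∃ G : StrongDual 𝕜 Y, ∀ a, G (j a) = F a := by
  have hinj : Function.Injective j := by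
    refine (injective_iff_map_eq_zero j).2 fun a ha => ?_
    have := hj a
    rw [ha, norm_zero, mul_zero] at this
    exact norm_le_zero_iff.1 this
  let e := LinearEquiv.ofInjective j hinj
  obtain ⟨G, hG, -⟩ := exists_extension_norm_eq (LinearMap.range j)
    ((F.toLinearMap ∘ₗ e.symm.toLinearMap).mkContinuous (‖F‖ * C) fun y => by
      refine (F.le_opNorm _).trans ?_
      rw [mul_assoc]
      gcongr
      refine (hj _).trans (le_of_eq ?_)
      congr 1
      change ‖((e (e.symm y) : LinearMap.range j) : Y)‖ = _
      rw [e.apply_symm_apply]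
      rfl)
  refine ⟨G, fun a => ?_⟩
  have := hG (e a)
  rw [LinearMap.mkContinuous_apply, LinearMap.comp_apply, LinearEquiv.coe_coe,
    e.symm_apply_apply] at this
  exact this

/-! ### Norms of `ℓ^q` products -/

section WithLpProd
variable {Y Z : Type*} [NormedAddCommGroup Y] [NormedAddCommGroup Z] {q : ℝ≥0∞}

theorem WithLp.norm_toLp_le_add [Fact (1 ≤ q)] (x : Y) (y : Z) :
    ‖WithLp.toLp q (x, y)‖ ≤ ‖x‖ + ‖y‖ := by
  have e : WithLp.toLp q (x, y) = WithLp.toLp q (x, 0) + WithLp.toLp q (0, y) := by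
    rw [← WithLp.toLp_add]; simp
  rw [e]
  refine (norm_add_le _ _).trans (le_of_eq ?_)
  rw [WithLp.norm_toLp_fst, WithLp.norm_toLp_snd]

theorem WithLp.norm_rpow_eq_add (hq : 0 < q.toReal) (b : WithLp q (Y × Z)) :
    ‖b‖ ^ q.toReal = ‖b.fst‖ ^ q.toReal + ‖b.snd‖ ^ q.toReal := by
  rw [WithLp.prod_norm_eq_add hq, ← Real.rpow_mul (by positivity), one_div_mul_cancel hq.ne',
    Real.rpow_one]

end WithLpProd

/-! ### Dyadic discretization of the interpolation norm -/

theorem Ioi_zero_eq_iUnion_Ico_zpow :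
    Ioi (0 : ℝ) = ⋃ k : ℤ, Ico ((2 : ℝ) ^ k) (2 ^ (k + 1)) := by
  ext t
  simp only [mem_Ioi, mem_iUnion]
  refine ⟨fun ht => exists_mem_Ico_zpow ht one_lt_two, ?_⟩
  rintro ⟨k, hk⟩
  exact lt_of_lt_of_le (by positivity) hk.1

theorem lintegral_Ioi_zero_eq_tsum (g : ℝ → ℝ≥0∞) :
    ∫⁻ t in Ioi (0 : ℝ), g t = ∑' k : ℤ, ∫⁻ t in Ico ((2 : ℝ) ^ k) (2 ^ (k + 1)), g t := by
  rw [Ioi_zero_eq_iUnion_Ico_zpow, lintegral_iUnion (fun k => measurableSet_Ico)]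
  have hm : Monotone fun k : ℤ => (2 : ℝ) ^ k := fun i j hij =>
    zpow_le_zpow_right₀ one_le_two hij
  simpa using hm.pairwise_disjoint_on_Ico_succ

theorem volume_Ico_zpow (k : ℤ) :
    volume (Ico ((2 : ℝ) ^ k) (2 ^ (k + 1))) = ENNReal.ofReal (2 ^ k) := by
  rw [Real.volume_Ico, zpow_add_one₀ two_ne_zero]
  congr 1; ring

theorem ofReal_zpow_succ_rpow_le {θ : ℝ} (hθ : θ ∈ Ioo (0 : ℝ) 1) (k : ℤ) :
    ENNReal.ofReal (((2 : ℝ) ^ (k + 1)) ^ θ) ≤ 2 * ENNReal.ofReal (((2 : ℝ) ^ k) ^ θ) := by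
  rw [← ENNReal.ofReal_ofNat 2, ← ENNReal.ofReal_mul zero_le_two]
  apply ENNReal.ofReal_le_ofReal
  rw [zpow_add_one₀ two_ne_zero, Real.mul_rpow (by positivity) zero_le_two, mul_comm]
  gcongr
  simpa using Real.rpow_le_rpow_of_exponent_le one_le_two hθ.2.le

theorem div_le_two_mul_div {x a b : ℝ≥0∞} (h : b ≤ 2 * a) : x / a ≤ 2 * (x / b) := by
  rw [← mul_div_assoc]
  have h2 : x / a = 2 * x / (2 * a) :=
    (ENNReal.mul_div_mul_left _ _ two_ne_zero ENNReal.ofNat_ne_top).symm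
  rw [h2]
  gcongr

theorem two_mul_two_rpow_le {p : ℝ} (hp : 1 < p) : (2 * 2 ^ p : ℝ≥0∞) ≤ 4 ^ p := by
  have h4 : (4 : ℝ≥0∞) = 2 * 2 := by norm_num
  rw [h4, ENNReal.mul_rpow_of_nonneg _ _ (by linarith)]
  gcongr
  simpa using ENNReal.rpow_le_rpow_of_exponent_le (x := 2) (by norm_num) hp.le

namespace InterpolationCouple

variable {𝕜 B₀ B₁ V : Type*} [RCLike 𝕜]
  [NormedAddCommGroup B₀] [NormedSpace 𝕜 B₀] [CompleteSpace B₀]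
  [NormedAddCommGroup B₁] [NormedSpace 𝕜 B₁] [CompleteSpace B₁]
  [AddCommGroup V] [Module 𝕜 V] [TopologicalSpace V] [IsTopologicalAddGroup V]
  [ContinuousSMul 𝕜 V] [T2Space V]

/-- The sequence `K(2 ^ k, a) / (2 ^ k) ^ θ` sampling the integrand of `eNorm`. -/
noncomputable def dyadicK (B : InterpolationCouple 𝕜 B₀ B₁ V) (θ : ℝ) (a : V) (k : ℤ) : ℝ≥0∞ :=
  B.K (2 ^ k) a / ENNReal.ofReal (((2 : ℝ) ^ k) ^ θ)

theorem lintegral_le_tsum_dyadicK (B : InterpolationCouple 𝕜 B₀ B₁ V) {θ p : ℝ}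
    (hθ : θ ∈ Ioo (0 : ℝ) 1) (hp : 1 < p) (a : V) :
    ∫⁻ t in Ioi (0 : ℝ), (B.K t a / ENNReal.ofReal (t ^ θ)) ^ p / ENNReal.ofReal t ≤
      2 ^ p * ∑' k, B.dyadicK θ a k ^ p := by
  have hp0 : 0 ≤ p := by linarith
  rw [lintegral_Ioi_zero_eq_tsum,
    ← (Equiv.addRight (1 : ℤ)).tsum_eq (fun k => B.dyadicK θ a k ^ p),
    ← ENNReal.tsum_mul_left]
  refine ENNReal.tsum_le_tsum fun k => ?_
  have hk : (0 : ℝ) < 2 ^ k := by positivity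
  calc ∫⁻ t in Ico ((2 : ℝ) ^ k) (2 ^ (k + 1)),
        (B.K t a / ENNReal.ofReal (t ^ θ)) ^ p / ENNReal.ofReal t
      ≤ ∫⁻ t in Ico ((2 : ℝ) ^ k) (2 ^ (k + 1)),
        (2 * B.dyadicK θ a (k + 1)) ^ p / ENNReal.ofReal (2 ^ k) := by
        refine setLIntegral_mono' measurableSet_Ico fun t ht => ?_
        gcongr ?_ ^ p / ENNReal.ofReal ?_
        · calc B.K t a / ENNReal.ofReal (t ^ θ)
              ≤ B.K (2 ^ (k + 1)) a / ENNReal.ofReal (((2 : ℝ) ^ k) ^ θ) := by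
                gcongr
                · exact B.K_mono a ht.2.le
                · exact hθ.1.le
                · exact ht.1
            _ ≤ _ := div_le_two_mul_div (ofReal_zpow_succ_rpow_le hθ k)
        · exact ht.1
    _ = 2 ^ p * B.dyadicK θ a (k + 1) ^ p := by
        rw [setLIntegral_const, volume_Ico_zpow,
          ENNReal.div_mul_cancel (ENNReal.ofReal_pos.2 hk).ne' ENNReal.ofReal_ne_top,
          ENNReal.mul_rpow_of_nonneg _ _ hp0]

theorem tsum_dyadicK_le_lintegral (B : InterpolationCouple 𝕜 B₀ B₁ V) {θ p : ℝ}
    (hθ : θ ∈ Ioo (0 : ℝ) 1) (hp : 1 < p) (a : V) :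
    ∑' k, B.dyadicK θ a k ^ p ≤ 2 * 2 ^ p *
      ∫⁻ t in Ioi (0 : ℝ), (B.K t a / ENNReal.ofReal (t ^ θ)) ^ p / ENNReal.ofReal t := by
  have hp0 : 0 ≤ p := by linarith
  rw [lintegral_Ioi_zero_eq_tsum, ← ENNReal.tsum_mul_left]
  refine ENNReal.tsum_le_tsum fun k => ?_
  have hk : (0 : ℝ) < 2 ^ k := by positivity
  have hk' : ENNReal.ofReal (2 ^ (k + 1)) = 2 * ENNReal.ofReal (2 ^ k) := by
    rw [zpow_add_one₀ two_ne_zero, mul_comm, ENNReal.ofReal_mul zero_le_two,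
      ENNReal.ofReal_ofNat]
  calc B.dyadicK θ a k ^ p
      = 2 * ∫⁻ t in Ico ((2 : ℝ) ^ k) (2 ^ (k + 1)),
        (B.dyadicK θ a k) ^ p / ENNReal.ofReal (2 ^ (k + 1)) := by
        rw [setLIntegral_const, volume_Ico_zpow, hk', mul_left_comm,
          ENNReal.div_mul_cancel
            (mul_ne_zero two_ne_zero (ENNReal.ofReal_pos.2 hk).ne')
            (ENNReal.mul_ne_top ENNReal.ofNat_ne_top ENNReal.ofReal_ne_top)]
    _ ≤ 2 * ∫⁻ t in Ico ((2 : ℝ) ^ k) (2 ^ (k + 1)),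
        2 ^ p * ((B.K t a / ENNReal.ofReal (t ^ θ)) ^ p / ENNReal.ofReal t) := by
        gcongr 2 * ?_
        refine setLIntegral_mono' measurableSet_Ico fun t ht => ?_
        rw [← mul_div_assoc, ← ENNReal.mul_rpow_of_nonneg _ _ hp0]
        have ht0 : 0 < t := hk.trans_le ht.1
        gcongr ?_ ^ p / ENNReal.ofReal ?_
        · refine (div_le_two_mul_div (ofReal_zpow_succ_rpow_le hθ k)).trans ?_
          gcongr
          · exact B.K_mono a ht.1
          · exact hθ.1.le
          · exact ht.2.le
        · exact ht.2.le
    _ = _ := by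
        rw [lintegral_const_mul' _ _ (ENNReal.rpow_ne_top_of_nonneg hp0 ENNReal.ofNat_ne_top),
          mul_assoc]

/-! ### Quotient norms on `B₀ + B₁` -/

section SumSpace
variable (B : InterpolationCouple 𝕜 B₀ B₁ V) (q : ℝ≥0∞) (α t : ℝ)

/-- The weighted addition map `(b₀, b₁) ↦ α b₀ + (α / t) b₁` into the ambient space. -/
noncomputable def sumMap : WithLp q (B₀ × B₁) →L[𝕜] V :=
  (((α : 𝕜) • B.j₀).comp (ContinuousLinearMap.fst 𝕜 B₀ B₁) +
    (((α / t : ℝ) : 𝕜) • B.j₁).comp (ContinuousLinearMap.snd 𝕜 B₀ B₁)).comp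
    (WithLp.prodContinuousLinearEquiv q 𝕜 B₀ B₁ : WithLp q (B₀ × B₁) →L[𝕜] B₀ × B₁)

theorem sumMap_apply (b : WithLp q (B₀ × B₁)) :
    B.sumMap q α t b = (α : 𝕜) • B.j₀ b.fst + ((α / t : ℝ) : 𝕜) • B.j₁ b.snd := rfl

/-- The space `B₀ + B₁` as the quotient of the `ℓ^q` sum of `B₀` and `B₁` by the kernel of
`sumMap`; the class of `b` stands for the vector `sumMap b`. For `q < ∞` and `α, t > 0` the
quotient norm of `a` is `α⁻¹ inf (‖a₀‖ ^ q + (t ‖a₁‖) ^ q) ^ (1 / q)` over the decompositions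
`a = a₀ + a₁`, a variant of `K(t, a) / α` that remembers the norms of both parts. -/
abbrev SumSpace : Type _ :=
  WithLp q (B₀ × B₁) ⧸ LinearMap.ker (B.sumMap q α t : WithLp q (B₀ × B₁) →ₗ[𝕜] V)

noncomputable instance [Fact (1 ≤ q)] : NormedAddCommGroup (B.SumSpace q α t) :=
  Submodule.Quotient.normedAddCommGroup _ (hS := (B.sumMap q α t).isClosed_ker)

noncomputable instance [Fact (1 ≤ q)] : NormedSpace 𝕜 (B.SumSpace q α t) :=
  inferInstanceAs (NormedSpace 𝕜
    (_ ⧸ LinearMap.ker (B.sumMap q α t : WithLp q (B₀ × B₁) →ₗ[𝕜] V)))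

variable {α t} {θ p : ℝ} {hp : 1 < p}

/-- Every decomposition `a = a₀ + a₁` is rescaled to a preimage of `a` under `sumMap`. -/
theorem sumMap_decomp (hα : 0 < α) (ht : 0 < t) (a₀ : B₀) (a₁ : B₁) :
    B.sumMap q α t (WithLp.toLp q (((α⁻¹ : ℝ) : 𝕜) • a₀, ((t / α : ℝ) : 𝕜) • a₁)) =
      B.j₀ a₀ + B.j₁ a₁ := by
  rw [sumMap_apply]
  change (α : 𝕜) • B.j₀ (((α⁻¹ : ℝ) : 𝕜) • a₀) +
    ((α / t : ℝ) : 𝕜) • B.j₁ (((t / α : ℝ) : 𝕜) • a₁) = _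
  rw [map_smul, map_smul, smul_smul, smul_smul, ← RCLike.ofReal_mul, ← RCLike.ofReal_mul]
  rw [mul_inv_cancel₀ hα.ne', show α / t * (t / α) = 1 by field_simp]
  simp

theorem incl_mem_range (hα : 0 < α) (ht : 0 < t) (a : B.RealInterp θ p hp) :
    B.incl θ p hp a ∈ LinearMap.range (B.sumMap q α t : WithLp q (B₀ × B₁) →ₗ[𝕜] V) := by
  obtain ⟨a₀, a₁, h⟩ := (Subtype.prop (p := fun v => v ∈ B.realSubmodule θ p hp) a).1
  exact ⟨_, (B.sumMap_decomp q hα ht a₀ a₁).trans h.symm⟩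

/-- The inclusion of `B_{θ,p}` in `B₀ + B₁`. -/
noncomputable def toSum (hα : 0 < α) (ht : 0 < t) :
    B.RealInterp θ p hp →ₗ[𝕜] B.SumSpace q α t :=
  (LinearMap.quotKerEquivRange
      (B.sumMap q α t : WithLp q (B₀ × B₁) →ₗ[𝕜] V)).symm.toLinearMap ∘ₗ
    LinearMap.codRestrict _ (B.incl θ p hp) (B.incl_mem_range q hα ht)

theorem toSum_eq_mk_iff (hα : 0 < α) (ht : 0 < t) (a : B.RealInterp θ p hp)
    (b : WithLp q (B₀ × B₁)) :
    B.toSum q hα ht a = Submodule.Quotient.mk b ↔ B.sumMap q α t b = B.incl θ p hp a := by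
  rw [toSum, LinearMap.comp_apply, LinearEquiv.coe_coe, LinearEquiv.symm_apply_eq, eq_comm,
    Subtype.ext_iff]
  rfl

/-- Changing the parameters of `sumMap` amounts to rescaling both components. -/
theorem toSum_eq_mk_of_sumMap_eq {α' t' : ℝ} (hα : 0 < α) (ht : 0 < t) (hα' : 0 < α')
    (ht' : 0 < t') {a : B.RealInterp θ p hp} {b : WithLp q (B₀ × B₁)}
    (h : B.sumMap q α' t' b = B.incl θ p hp a) :
    B.toSum q hα ht a = Submodule.Quotient.mk (WithLp.toLp q
      (((α' / α : ℝ) : 𝕜) • b.fst, ((α' / t' * (t / α) : ℝ) : 𝕜) • b.snd)) := by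
  refine (B.toSum_eq_mk_iff q hα ht _ _).2 ?_
  rw [← h, sumMap_apply, sumMap_apply]
  change (α : 𝕜) • B.j₀ (((α' / α : ℝ) : 𝕜) • b.fst) +
    ((α / t : ℝ) : 𝕜) • B.j₁ (((α' / t' * (t / α) : ℝ) : 𝕜) • b.snd) = _
  rw [map_smul, map_smul, smul_smul, smul_smul, ← RCLike.ofReal_mul, ← RCLike.ofReal_mul,
    show α * (α' / α) = α' by field_simp,
    show α / t * (α' / t' * (t / α)) = α' / t' by field_simp]

variable [Fact (1 ≤ q)]

theorem enorm_toSum_le (hα : 0 < α) (ht : 0 < t) (a : B.RealInterp θ p hp) :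
    ‖B.toSum q hα ht a‖ₑ ≤ B.K t (B.incl θ p hp a) / ENNReal.ofReal α := by
  rw [ENNReal.le_div_iff_mul_le (Or.inl (ENNReal.ofReal_pos.2 hα).ne')
    (Or.inl ENNReal.ofReal_ne_top)]
  refine le_iInf fun a₀ => le_iInf fun a₁ => le_iInf fun h => ?_
  rw [← ofReal_norm, ← ENNReal.ofReal_mul (norm_nonneg _), ← ENNReal.ofReal_mul ht.le,
    ← ENNReal.ofReal_add (norm_nonneg _) (by positivity)]
  apply ENNReal.ofReal_le_ofReal
  rw [(B.toSum_eq_mk_iff q hα ht a _).2 ((B.sumMap_decomp q hα ht a₀ a₁).trans h)]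
  calc _ ≤ (‖((α⁻¹ : ℝ) : 𝕜) • a₀‖ + ‖((t / α : ℝ) : 𝕜) • a₁‖) * α := by
        gcongr
        exact (Submodule.Quotient.norm_mk_le _ _).trans (WithLp.norm_toLp_le_add _ _)
    _ = _ := by
        rw [norm_smul, norm_smul, RCLike.norm_ofReal, RCLike.norm_ofReal,
          abs_of_pos (inv_pos.2 hα), abs_of_pos (div_pos ht hα)]
        field_simp

theorem K_div_le_enorm_toSum (hα : 0 < α) (ht : 0 < t) (a : B.RealInterp θ p hp) :
    B.K t (B.incl θ p hp a) / ENNReal.ofReal α ≤ 2 * ‖B.toSum q hα ht a‖ₑ := by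
  refine ENNReal.div_le_of_le_mul (ENNReal.le_of_forall_pos_le_add fun ε hε _ => ?_)
  have hε' : (0 : ℝ) < ε / (2 * α) := div_pos hε (by positivity)
  obtain ⟨b, hb, hbn⟩ := Submodule.Quotient.norm_mk_lt (B.toSum q hα ht a) hε'
  have hK := (B.toSum_eq_mk_iff q hα ht a b).1 hb.symm
  rw [sumMap_apply, ← map_smul, ← map_smul] at hK
  refine iInf_le_of_le _ (iInf_le_of_le _ (iInf_le_of_le hK ?_))
  rw [← ENNReal.ofReal_mul ht.le, ← ofReal_norm, ← ENNReal.ofReal_ofNat 2,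
    ← ENNReal.ofReal_mul zero_le_two, ← ENNReal.ofReal_mul (by positivity),
    ← ENNReal.ofReal_coe_nnreal, ← ENNReal.ofReal_add (norm_nonneg _) (by positivity),
    ← ENNReal.ofReal_add (by positivity) ε.coe_nonneg]
  apply ENNReal.ofReal_le_ofReal
  rw [norm_smul, norm_smul, RCLike.norm_ofReal, RCLike.norm_ofReal, abs_of_pos hα,
    abs_of_pos (div_pos hα ht)]
  have h1 := WithLp.norm_fst_le B₀ b
  have h2 := WithLp.norm_snd_le B₀ b
  calc α * ‖b.fst‖ + t * (α / t * ‖b.snd‖) = α * ‖b.fst‖ + α * ‖b.snd‖ := by field_simp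
    _ ≤ α * ‖b‖ + α * ‖b‖ := by gcongr
    _ = 2 * α * ‖b‖ := by ring
    _ ≤ 2 * α * (‖B.toSum q hα ht a‖ + ε / (2 * α)) := by gcongr
    _ = _ := by field_simp

end SumSpace


/-! ### Weakly convergent decompositions -/

section Coordinates
variable (B : InterpolationCouple 𝕜 B₀ B₁ V) {q : ℝ≥0∞} [Fact (1 ≤ q)] {α t θ p : ℝ} {hp : 1 < p}

theorem exists_sumMap_eq_norm_rpow_le (hq : 0 < q.toReal) (hα : 0 < α) (ht : 0 < t)
    (a : B.RealInterp θ p hp) {ε : ℝ} (hε : 0 < ε) :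
    ∃ b : WithLp q (B₀ × B₁), B.sumMap q α t b = B.incl θ p hp a ∧
      ‖b‖ ^ q.toReal ≤ ‖B.toSum q hα ht a‖ ^ q.toReal + ε := by
  set s := ‖B.toSum q hα ht a‖ with hs
  set r := (s ^ q.toReal + ε) ^ (1 / q.toReal) with hr
  have hs0 : 0 ≤ s ^ q.toReal := Real.rpow_nonneg (norm_nonneg _) _
  have hrq : r ^ q.toReal = s ^ q.toReal + ε := by
    rw [hr, ← Real.rpow_mul (by linarith), one_div_mul_cancel hq.ne', Real.rpow_one]
  have hsr : s < r := by
    rw [← Real.rpow_lt_rpow_iff (norm_nonneg _) (by positivity) hq, hrq]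
    linarith
  obtain ⟨b, hb, hbn⟩ := Submodule.Quotient.norm_mk_lt (B.toSum q hα ht a) (sub_pos.2 hsr)
  refine ⟨b, (B.toSum_eq_mk_iff q hα ht a b).1 hb.symm, ?_⟩
  rw [← hrq]
  gcongr
  linarith

/-- If two bounded sequences of `B_{θ,p}` asymptotically attain equality in the convexity
inequality for one of the norms of `B₀ + B₁`, then they have bounded decompositions whose parts
in the weakly uniformly rotund space `B₀` have weakly null difference. -/
theorem exists_decomp_tendsto (hWUR : IsWUR (normSeminorm 𝕜 B₀)) (hq : 1 < q.toReal)
    (hα : 0 < α) (ht : 0 < t) {x y : ℕ → B.RealInterp θ p hp}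
    (hx : ∀ n, ‖B.toSum q hα ht (x n)‖ ≤ 1) (hy : ∀ n, ‖B.toSum q hα ht (y n)‖ ≤ 1)
    (hD : Tendsto (fun n => (‖B.toSum q hα ht (x n)‖ ^ q.toReal +
      ‖B.toSum q hα ht (y n)‖ ^ q.toReal) / 2 -
      (‖B.toSum q hα ht (x n) + B.toSum q hα ht (y n)‖ / 2) ^ q.toReal) atTop (𝓝 0)) :
    ∃ b c : ℕ → WithLp q (B₀ × B₁),
      (∀ n, B.sumMap q α t (b n) = B.incl θ p hp (x n)) ∧
      (∀ n, B.sumMap q α t (c n) = B.incl θ p hp (y n)) ∧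
      (∀ n, ‖b n‖ ≤ 2) ∧ (∀ n, ‖c n‖ ≤ 2) ∧
      ∀ f : StrongDual 𝕜 B₀, Tendsto (fun n => f ((b n).fst - (c n).fst)) atTop (𝓝 0) := by
  have hq0 : 0 < q.toReal := by linarith
  have hε : ∀ n : ℕ, (0 : ℝ) < 1 / ((n : ℝ) + 1) := fun n => by positivity
  choose b hb hbn using fun n =>
    B.exists_sumMap_eq_norm_rpow_le hq0 hα ht (x n) (hε n)
  choose c hc hcn using fun n =>
    B.exists_sumMap_eq_norm_rpow_le hq0 hα ht (y n) (hε n)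
  have two_bound : ∀ {s r : ℝ} (n : ℕ), 0 ≤ s → 0 ≤ r → r ≤ 1 →
      s ^ q.toReal ≤ r ^ q.toReal + 1 / ((n : ℝ) + 1) → s ≤ 2 := by
    intro s r n hs hr hr1 h
    rw [← Real.rpow_le_rpow_iff hs zero_le_two hq0]
    have h1 : r ^ q.toReal ≤ 1 := Real.rpow_le_one hr hr1 hq0.le
    have h2 : 1 / ((n : ℝ) + 1) ≤ 1 := by
      rw [div_le_one (by positivity)]; linarith [(Nat.cast_nonneg n : (0 : ℝ) ≤ n)]
    have h3 : (2 : ℝ) ≤ 2 ^ q.toReal := Real.self_le_rpow_of_one_le one_le_two hq.le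
    linarith
  have hb2 : ∀ n, ‖b n‖ ≤ 2 := fun n =>
    two_bound n (norm_nonneg _) (norm_nonneg _) (hx n) (hbn n)
  have hc2 : ∀ n, ‖c n‖ ≤ 2 := fun n =>
    two_bound n (norm_nonneg _) (norm_nonneg _) (hy n) (hcn n)
  refine ⟨b, c, hb, hc, hb2, hc2, ?_⟩
  refine hWUR.tendsto_apply_sub hq (M := 2)
    (fun n => (WithLp.norm_fst_le B₀ (b n)).trans (hb2 n))
    (fun n => (WithLp.norm_fst_le B₀ (c n)).trans (hc2 n)) ?_
  have hlim := hD.add (tendsto_one_div_add_atTop_nhds_zero_nat (𝕜 := ℝ))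
  rw [add_zero] at hlim
  refine squeeze_zero (fun n => sub_nonneg.2 (norm_add_div_two_rpow_le hq _ _)) (fun n => ?_) hlim
  -- the convexity defect of the `B₁` parts is nonnegative, so it can be added
  have h1 := norm_add_div_two_rpow_le hq (b n).snd (c n).snd
  have hsum : B.toSum q hα ht (x n) + B.toSum q hα ht (y n) =
      Submodule.Quotient.mk (b n + c n) := by
    rw [← map_add]
    refine (B.toSum_eq_mk_iff q hα ht _ _).2 ?_
    rw [map_add, map_add, hb, hc]
  have h2 : (‖B.toSum q hα ht (x n) + B.toSum q hα ht (y n)‖ / 2) ^ q.toReal ≤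
      (‖(b n).fst + (c n).fst‖ / 2) ^ q.toReal + (‖(b n).snd + (c n).snd‖ / 2) ^ q.toReal := by
    have h3 : ‖B.toSum q hα ht (x n) + B.toSum q hα ht (y n)‖ ≤ ‖b n + c n‖ := by
      rw [hsum]; exact Submodule.Quotient.norm_mk_le _ _
    calc _ ≤ (‖b n + c n‖ / 2) ^ q.toReal := by gcongr
      _ = _ := by
        rw [Real.div_rpow (norm_nonneg _) zero_le_two, WithLp.norm_rpow_eq_add hq0, add_div,
          ← Real.div_rpow (norm_nonneg _) zero_le_two, ← Real.div_rpow (norm_nonneg _) zero_le_two]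
        rfl
  have h4 := hbn n
  have h5 := hcn n
  rw [WithLp.norm_rpow_eq_add hq0] at h4 h5
  linarith

/-- The restriction to `B₀` of a continuous functional on `B₀ + B₁` is continuous. -/
theorem exists_strongDual_fst (g : StrongDual 𝕜 (B.SumSpace q α t)) :
    ∃ f : StrongDual 𝕜 B₀, ∀ b₀, f b₀ = g (Submodule.Quotient.mk (WithLp.toLp q (b₀, 0))) := by
  refine ⟨LinearMap.mkContinuous (g.toLinearMap ∘ₗ
    (LinearMap.ker (B.sumMap q α t : WithLp q (B₀ × B₁) →ₗ[𝕜] V)).mkQ ∘ₗ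
    (WithLp.linearEquiv q 𝕜 (B₀ × B₁)).symm.toLinearMap ∘ₗ LinearMap.inl 𝕜 B₀ B₁) ‖g‖
    (fun b₀ => ?_), fun b₀ => rfl⟩
  refine (g.le_opNorm _).trans ?_
  gcongr
  refine (Submodule.Quotient.norm_mk_le _ _).trans (le_of_eq ?_)
  exact WithLp.norm_toLp_fst q B₀ B₁ b₀

end Coordinates

/-! ### The diagonal embedding of the interpolation space in an `ℓ^p` sum -/

section Dyadic
variable (B : InterpolationCouple 𝕜 B₀ B₁ V) {θ p : ℝ} {hp : 1 < p}

/-- The space `B₀ + B₁` with the norm of index `k ∈ ℤ`, comparable with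
`a ↦ K(2 ^ k, a) / (2 ^ k) ^ θ`. -/
abbrev DyadicSum (q : ℝ≥0∞) (θ : ℝ) (k : ℤ) : Type _ := B.SumSpace q (((2 : ℝ) ^ k) ^ θ) (2 ^ k)

/-- The inclusion of `B_{θ,p}` in `B₀ + B₁` with the norm of index `k`. -/
noncomputable def toDyadicSum (q : ℝ≥0∞) (k : ℤ) :
    B.RealInterp θ p hp →ₗ[𝕜] B.DyadicSum q θ k :=
  B.toSum q (α := ((2 : ℝ) ^ k) ^ θ) (t := 2 ^ k) (by positivity) (by positivity)

variable {q : ℝ≥0∞} [Fact (1 ≤ q)]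

theorem enorm_eq_eNorm (a : B.RealInterp θ p hp) : ‖a‖ₑ = B.eNorm θ p (B.incl θ p hp a) := by
  rw [← ofReal_norm, norm_def, ENNReal.ofReal_toReal (B.eNorm_incl_ne_top θ p hp a)]

theorem enorm_rpow_eq_lintegral (a : B.RealInterp θ p hp) :
    ‖a‖ₑ ^ p = ∫⁻ t in Ioi (0 : ℝ),
      (B.K t (B.incl θ p hp a) / ENNReal.ofReal (t ^ θ)) ^ p / ENNReal.ofReal t := by
  rw [enorm_eq_eNorm, eNorm, ← ENNReal.rpow_mul, one_div_mul_cancel (by linarith),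
    ENNReal.rpow_one]

theorem tsum_enorm_toDyadicSum_le (hθ : θ ∈ Ioo (0 : ℝ) 1) (a : B.RealInterp θ p hp) :
    ∑' k, ‖B.toDyadicSum q k a‖ₑ ^ p ≤ (4 * ‖a‖ₑ) ^ p := by
  have hp0 : 0 ≤ p := by linarith
  calc ∑' k, ‖B.toDyadicSum q k a‖ₑ ^ p ≤ ∑' k, B.dyadicK θ (B.incl θ p hp a) k ^ p := by
        gcongr with k
        exact B.enorm_toSum_le q _ _ a
    _ ≤ 2 * 2 ^ p * ‖a‖ₑ ^ p := by
        rw [enorm_rpow_eq_lintegral]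
        exact B.tsum_dyadicK_le_lintegral hθ hp _
    _ ≤ 4 ^ p * ‖a‖ₑ ^ p := by gcongr; exact two_mul_two_rpow_le hp
    _ = _ := (ENNReal.mul_rpow_of_nonneg _ _ hp0).symm

theorem enorm_rpow_le_tsum_enorm_toDyadicSum (hθ : θ ∈ Ioo (0 : ℝ) 1)
    (a : B.RealInterp θ p hp) :
    ‖a‖ₑ ^ p ≤ 4 ^ p * ∑' k, ‖B.toDyadicSum q k a‖ₑ ^ p := by
  have hp0 : 0 ≤ p := by linarith
  calc ‖a‖ₑ ^ p ≤ 2 ^ p * ∑' k, B.dyadicK θ (B.incl θ p hp a) k ^ p := by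
        rw [enorm_rpow_eq_lintegral]
        exact B.lintegral_le_tsum_dyadicK hθ hp _
    _ ≤ 2 ^ p * ∑' k, (2 * ‖B.toDyadicSum q k a‖ₑ) ^ p := by
        gcongr with k
        exact B.K_div_le_enorm_toSum q _ _ a
    _ = _ := by
        simp only [ENNReal.mul_rpow_of_nonneg _ _ hp0]
        rw [ENNReal.tsum_mul_left, ← mul_assoc, ← ENNReal.mul_rpow_of_nonneg _ _ hp0]
        norm_num

theorem memℓp_toDyadicSum (hq : q.toReal = p) (hθ : θ ∈ Ioo (0 : ℝ) 1)
    (a : B.RealInterp θ p hp) :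
    Memℓp (fun k => B.toDyadicSum q k a) q := by
  have hp0 : 0 ≤ p := by linarith
  refine memℓp_gen ?_
  have h : ∑' k, ‖B.toDyadicSum q k a‖ₑ ^ p ≠ ∞ :=
    ne_top_of_le_ne_top (ENNReal.rpow_ne_top_of_nonneg hp0
      (ENNReal.mul_ne_top ENNReal.ofNat_ne_top enorm_ne_top))
      (B.tsum_enorm_toDyadicSum_le hθ a)
  refine (ENNReal.summable_toReal h).congr fun k => ?_
  rw [← ENNReal.toReal_rpow, toReal_enorm, hq]

/-- The diagonal embedding `a ↦ (a, a, …)` of `B_{θ,p}` in the `ℓ^p` sum of the spaces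
`B₀ + B₁` with the norms of index `k ∈ ℤ`. -/
noncomputable def toLp (hq : q.toReal = p) (hθ : θ ∈ Ioo (0 : ℝ) 1) :
    B.RealInterp θ p hp →ₗ[𝕜] lp (B.DyadicSum q θ) q where
  toFun a := ⟨fun k => B.toDyadicSum q k a, B.memℓp_toDyadicSum hq hθ a⟩
  map_add' a b := by ext k : 2; exact map_add (B.toDyadicSum q k) a b
  map_smul' c a := by ext k : 2; exact map_smul (B.toDyadicSum q k) c a

theorem toLp_apply (hq : q.toReal = p) (hθ : θ ∈ Ioo (0 : ℝ) 1) (a : B.RealInterp θ p hp)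
    (k : ℤ) : B.toLp hq hθ a k = B.toDyadicSum q k a := rfl

theorem enorm_toLp_rpow (hq : q.toReal = p) (hθ : θ ∈ Ioo (0 : ℝ) 1)
    (a : B.RealInterp θ p hp) :
    ‖B.toLp hq hθ a‖ₑ ^ p = ∑' k, ‖B.toDyadicSum q k a‖ₑ ^ p := by
  have hp0 : 0 < p := by linarith
  have h := lp.hasSum_norm (hq.symm ▸ hp0) (B.toLp hq hθ a)
  rw [hq] at h
  rw [← ofReal_norm, ENNReal.ofReal_rpow_of_nonneg (norm_nonneg _) hp0.le, ← h.tsum_eq,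
    ENNReal.ofReal_tsum_of_nonneg (fun k => by positivity) h.summable]
  refine tsum_congr fun k => ?_
  rw [← ENNReal.ofReal_rpow_of_nonneg (norm_nonneg _) hp0.le, ofReal_norm, toLp_apply]

theorem norm_toLp_le (hq : q.toReal = p) (hθ : θ ∈ Ioo (0 : ℝ) 1) (a : B.RealInterp θ p hp) :
    ‖B.toLp hq hθ a‖ ≤ 4 * ‖a‖ := by
  have hp0 : 0 < p := by linarith
  have h := B.tsum_enorm_toDyadicSum_le (q := q) hθ a
  rw [← B.enorm_toLp_rpow hq hθ, ENNReal.rpow_le_rpow_iff hp0] at h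
  have := ENNReal.toReal_mono (ENNReal.mul_ne_top ENNReal.ofNat_ne_top enorm_ne_top) h
  simpa using this

theorem norm_le_norm_toLp (hq : q.toReal = p) (hθ : θ ∈ Ioo (0 : ℝ) 1)
    (a : B.RealInterp θ p hp) : ‖a‖ ≤ 4 * ‖B.toLp hq hθ a‖ := by
  have hp0 : 0 < p := by linarith
  have h := B.enorm_rpow_le_tsum_enorm_toDyadicSum (q := q) hθ a
  rw [← B.enorm_toLp_rpow hq hθ, ← ENNReal.mul_rpow_of_nonneg _ _ hp0.le,
    ENNReal.rpow_le_rpow_iff hp0] at h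
  have := ENNReal.toReal_mono (ENNReal.mul_ne_top ENNReal.ofNat_ne_top enorm_ne_top) h
  simpa using this

/-! ### Weak uniform rotundity of the diagonal norm -/

/-- If the convexity defect of every coordinate tends to zero, every coordinate of the difference
is weakly null. To see this for the coordinate `k`, decompose with respect to the coordinate `m`:
the `B₀` parts are weakly null by rotundity, and the `B₁` parts have norm of order
`2 ^ (-(1 - θ) m)`, which is small for large `m`. -/
theorem tendsto_apply_toDyadicSum_sub (hWUR : IsWUR (normSeminorm 𝕜 B₀)) (hq : 1 < q.toReal)
    (hθ : θ ∈ Ioo (0 : ℝ) 1) {x y : ℕ → B.RealInterp θ p hp}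
    (hx : ∀ n k, ‖B.toDyadicSum q k (x n)‖ ≤ 1) (hy : ∀ n k, ‖B.toDyadicSum q k (y n)‖ ≤ 1)
    (hD : ∀ k, Tendsto (fun n => (‖B.toDyadicSum q k (x n)‖ ^ q.toReal +
      ‖B.toDyadicSum q k (y n)‖ ^ q.toReal) / 2 -
      (‖B.toDyadicSum q k (x n) + B.toDyadicSum q k (y n)‖ / 2) ^ q.toReal) atTop (𝓝 0))
    (k : ℤ) (g : StrongDual 𝕜 (B.DyadicSum q θ k)) :
    Tendsto (fun n => g (B.toDyadicSum q k (x n - y n))) atTop (𝓝 0) := by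
  set σ : ℝ := 2 ^ k / ((2 : ℝ) ^ k) ^ θ with hσ
  have hσ0 : 0 < σ := by positivity
  have hsmall : Tendsto (fun m : ℕ => ‖g‖ * ((((2 : ℝ) ^ m) ^ θ / 2 ^ m * σ) * 4)) atTop
      (𝓝 0) := by
    have h1 : Tendsto (fun m : ℕ => ((2 : ℝ) ^ m) ^ (-(1 - θ))) atTop (𝓝 0) :=
      (tendsto_rpow_neg_atTop (sub_pos.2 hθ.2)).comp
        (tendsto_pow_atTop_atTop_of_one_lt one_lt_two)
    have h2 := ((h1.mul_const σ).mul_const 4).const_mul ‖g‖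
    rw [zero_mul, zero_mul, mul_zero] at h2
    refine h2.congr fun m => ?_
    rw [show -(1 - θ) = θ - 1 by ring, Real.rpow_sub_one (by positivity)]
  refine Metric.tendsto_atTop.2 fun ε hε => ?_
  obtain ⟨m, hm⟩ := (hsmall.eventually_lt_const (half_pos hε)).exists
  obtain ⟨b, c, hb, hc, hb2, hc2, hbc⟩ := B.exists_decomp_tendsto hWUR hq
    (α := ((2 : ℝ) ^ (m : ℤ)) ^ θ) (t := 2 ^ (m : ℤ)) (by positivity) (by positivity)
    (fun n => hx n m) (fun n => hy n m) (hD m)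
  obtain ⟨f, hf⟩ := B.exists_strongDual_fst g
  set ρ : ℝ := ((2 : ℝ) ^ (m : ℤ)) ^ θ / ((2 : ℝ) ^ k) ^ θ with hρ
  have hf0 : Tendsto (fun n => (ρ : 𝕜) * f ((b n).fst - (c n).fst)) atTop (𝓝 0) := by
    simpa using (hbc f).const_mul (ρ : 𝕜)
  obtain ⟨n₀, hn₀⟩ := Metric.tendsto_atTop.1 hf0 (ε / 2) (half_pos hε)
  refine ⟨n₀, fun n hn => ?_⟩
  have h1 := hn₀ n hn
  rw [dist_zero_right] at h1 ⊢
  have hz : B.sumMap q (((2 : ℝ) ^ (m : ℤ)) ^ θ) (2 ^ (m : ℤ)) (b n - c n) =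
      B.incl θ p hp (x n - y n) := by rw [map_sub, map_sub, hb, hc]
  set τ : ℝ := ((2 : ℝ) ^ (m : ℤ)) ^ θ / 2 ^ (m : ℤ) * σ with hτ
  have hτ0 : 0 ≤ τ := by positivity
  set w : B₁ := (τ : 𝕜) • (b n - c n).snd with hw
  have hwn : ‖w‖ ≤ τ * 4 := by
    rw [hw, norm_smul, RCLike.norm_ofReal, abs_of_nonneg hτ0]
    gcongr
    calc ‖(b n - c n).snd‖ ≤ ‖b n - c n‖ := WithLp.norm_snd_le B₀ _
      _ ≤ ‖b n‖ + ‖c n‖ := norm_sub_le _ _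
      _ ≤ 4 := by linarith [hb2 n, hc2 n]
  have hsplit : g (B.toDyadicSum q k (x n - y n)) =
      (ρ : 𝕜) * f ((b n).fst - (c n).fst) +
        g (Submodule.Quotient.mk (WithLp.toLp q (0, w))) := by
    rw [toDyadicSum, B.toSum_eq_mk_of_sumMap_eq q _ _ (by positivity) (by positivity) hz,
      ← smul_eq_mul (ρ : 𝕜), ← f.map_smul, hf, ← g.map_add,
      ← Submodule.Quotient.mk_add, ← WithLp.toLp_add, Prod.mk_add_mk, add_zero, zero_add]
    rfl
  have hg : ‖g (Submodule.Quotient.mk (WithLp.toLp q (0, w)))‖ < ε / 2 := by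
    refine (g.le_opNorm _).trans_lt (lt_of_le_of_lt ?_ hm)
    gcongr
    refine (Submodule.Quotient.norm_mk_le _ _).trans ?_
    rw [WithLp.norm_toLp_snd]
    simpa [hτ] using hwn
  rw [hsplit]
  exact (norm_add_le _ _).trans_lt (by linarith)

/-- The norm of the `ℓ^p` sum, restricted to the diagonal copy of `B_{θ,p}`, is weakly uniformly
rotund. -/
theorem isWUR_comp_toLp (hWUR : IsWUR (normSeminorm 𝕜 B₀)) (hq : q.toReal = p) (hq' : q ≠ ∞)
    (hθ : θ ∈ Ioo (0 : ℝ) 1) :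
    IsWUR ((normSeminorm 𝕜 (lp (B.DyadicSum q θ) q)).comp (B.toLp (hp := hp) hq hθ)) := by
  intro x y hx hy hxy
  have hq1 : 1 < q.toReal := hq.symm ▸ hp
  have hq0 : 0 < q.toReal := by linarith
  set j := B.toLp (hp := hp) hq hθ with hj
  replace hx : ∀ n, ‖j (x n)‖ = 1 := hx
  replace hy : ∀ n, ‖j (y n)‖ = 1 := hy
  replace hxy : Tendsto (fun n => ‖j (x n) + j (y n)‖) atTop (𝓝 2) :=
    hxy.congr fun n => congrArg norm (map_add j (x n) (y n))
  refine tendsto_toWeakSpace_zero_iff.2 fun F => ?_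
  obtain ⟨G, hG⟩ := exists_strongDual_apply_eq j (B.norm_le_norm_toLp hq hθ) F
  simp only [← hG]
  refine lp.tendsto_apply_of_forall_tendsto hq1 hq' (M := 2) (fun n => ?_) (fun k g => ?_) G
  · rw [map_sub]
    refine (norm_sub_le _ _).trans ?_
    rw [hx, hy]; norm_num
  have hle : ∀ (a : B.RealInterp θ p hp) (k : ℤ), ‖B.toDyadicSum q k a‖ ≤ ‖j a‖ := fun a k =>
    lp.norm_apply_le_norm (ENNReal.toReal_pos_iff.1 hq0).1.ne' (j a) k
  refine B.tendsto_apply_toDyadicSum_sub hWUR hq1 hθ (fun n k => (hle _ k).trans (hx n).le)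
    (fun n k => (hle _ k).trans (hy n).le) (fun m => ?_) k g
  -- the nonnegative convexity defects of the coordinates add up to that of the `ℓ^p` norm
  have hlim : Tendsto (fun n => 1 - (‖j (x n) + j (y n)‖ / 2) ^ q.toReal) atTop (𝓝 0) := by
    have := ((hxy.div_const 2).rpow_const (p := q.toReal) (Or.inr hq0.le)).const_sub 1
    rwa [div_self two_ne_zero, Real.one_rpow, sub_self] at this
  refine squeeze_zero (fun n => sub_nonneg.2 (norm_add_div_two_rpow_le hq1 _ _)) (fun n => ?_)
    hlim
  have hs := (((lp.hasSum_norm hq0 (j (x n))).add (lp.hasSum_norm hq0 (j (y n)))).div_const 2).sub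
    ((lp.hasSum_norm hq0 (j (x n) + j (y n))).div_const (2 ^ q.toReal))
  simp only [← Real.div_rpow (norm_nonneg _) zero_le_two] at hs
  rw [hx, hy, Real.one_rpow, one_add_one_eq_two, div_self two_ne_zero] at hs
  exact le_hasSum hs m fun i _ => sub_nonneg.2 (norm_add_div_two_rpow_le hq1 _ _)

end Dyadic
end InterpolationCouple

/-- If the norm of `B₀` is weakly uniformly rotund, then the real interpolation space `B_{θ,p}`
admits an equivalent weakly uniformly rotund norm. -/
theorem mainTheorem5 {𝕜 B₀ B₁ V : Type*} [RCLike 𝕜]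
    [NormedAddCommGroup B₀] [NormedSpace 𝕜 B₀] [CompleteSpace B₀]
    [NormedAddCommGroup B₁] [NormedSpace 𝕜 B₁] [CompleteSpace B₁]
    [AddCommGroup V] [Module 𝕜 V] [TopologicalSpace V] [IsTopologicalAddGroup V]
    [ContinuousSMul 𝕜 V] [T2Space V]
    (B : InterpolationCouple 𝕜 B₀ B₁ V)
    (θ : ℝ) (hθ : θ ∈ Set.Ioo (0 : ℝ) 1) (p : ℝ) (hp : 1 < p)
    (hWUR : IsWUR (normSeminorm 𝕜 B₀)) :
    ∃ N : Seminorm 𝕜 (B.RealInterp θ p hp), IsEquivalentNorm N ∧ IsWUR N := by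
  have : Fact (1 ≤ ENNReal.ofReal p) := ⟨ENNReal.one_le_ofReal.2 hp.le⟩
  have hq : (ENNReal.ofReal p).toReal = p := ENNReal.toReal_ofReal (by linarith)
  refine ⟨_, ⟨1 / 4, 4, by norm_num, by norm_num, fun a => ⟨?_, B.norm_toLp_le hq hθ a⟩⟩,
    B.isWUR_comp_toLp hWUR hq ENNReal.ofReal_ne_top hθ⟩
  have h := B.norm_le_norm_toLp hq hθ a
  change 1 / 4 * ‖a‖ ≤ ‖B.toLp hq hθ a‖
  linarith
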